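/- Let $k\ge 2$ and $p\ge k$ be integers, and let $G=KG_{p,k}$ be the Kneser graph: its vertices are the $k$-element subsets of a $p$-element set, and two vertices are adjacent if and only if the corresponding subsets are disjoint. Let $n=\binom{p}{k}$ be the number of vertices of $G$, $m$ its number of edges, $\omega$ its clique number, $\mu_1\ge\mu_2\ge\cdots\ge\mu_n$ the eigenvalues of its adjacency matrix (listed with multiplicity), and $n^+$ the number of positive eigenvalues (counted with multiplicity). Then \[ \mu_1^2+\mu_2^2+\cdots+\mu_\ell^2\;\le\;\frac{2m(\omega-1)}{\omega},\qquad\text{where }\ell=\min(n^+,\omega). \] -/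

import Mathlib

/-- The Kneser graph `KG_{p,k}`: the vertices are the `k`-element subsets of a `p`-element set, and
two distinct vertices are adjacent iff the sets are disjoint. (For `k ≥ 1` disjoint `k`-sets are
automatically distinct; the condition only excludes a loop at the empty set when `k = 0`.) -/
def kneserGraph (p k : ℕ) : SimpleGraph {s : Finset (Fin p) // s.card = k} where
  Adj s t := s ≠ t ∧ Disjoint s.1 t.1
  symm := ⟨fun _ _ h => ⟨h.1.symm, h.2.symm⟩⟩
  loopless := ⟨fun _ h => h.1 rfl⟩

instance kneserGraph.decidableAdj (p k : ℕ) : DecidableRel (kneserGraph p k).Adj :=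
  fun s t => inferInstanceAs (Decidable (s ≠ t ∧ Disjoint s.1 t.1))

theorem adjMatrix_isHermitian_real {V : Type*} (G : SimpleGraph V) [DecidableRel G.Adj] :
    (G.adjMatrix ℝ).IsHermitian := by
  rw [Matrix.IsHermitian, Matrix.conjTranspose_eq_transpose_of_trivial]
  exact G.isSymm_adjMatrix

section GraphSpectrum

variable {V : Type*} [Fintype V] [DecidableEq V] (G : SimpleGraph V) [DecidableRel G.Adj]

/-- The adjacency eigenvalues `μ₁ ≥ μ₂ ≥ ⋯ ≥ μₙ` of `G`, with multiplicity, in nonincreasing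
order. The index starts at `0`, so `adjEigenvalue G i` is `μ_{i+1}`. -/
noncomputable def adjEigenvalue : Fin (Fintype.card V) → ℝ :=
  (adjMatrix_isHermitian_real G).eigenvalues₀

theorem adjEigenvalue_antitone : Antitone (adjEigenvalue G) :=
  (adjMatrix_isHermitian_real G).eigenvalues₀_antitone

/-- `n⁺(G)`: the number of positive adjacency eigenvalues, counted with multiplicity. -/
noncomputable def numPosEigenvalues : ℕ :=
  (Finset.univ.filter fun i => 0 < adjEigenvalue G i).card

/-- `μ₁² + ⋯ + μ_ℓ²`, the sum of the squares of the `ℓ` largest adjacency eigenvalues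
(for `ℓ` at most the number of vertices). -/
noncomputable def sumSqLargestEigenvalues (ℓ : ℕ) : ℝ :=
  ∑ i : Fin (Fintype.card V) with i.val < ℓ, adjEigenvalue G i ^ 2

end GraphSpectrum

/-!
Write `a = p - k` and assume `2 * k ≤ p`; otherwise the graph has no edges and both sides vanish.

The spectrum is controlled by superset sums. For an eigenvector `f` with eigenvalue `c`, let `J` be
a set of least size `j` with `∑_{T ⊇ J} f T ≠ 0`. Summing the eigenvalue equation over the `k`-sets
containing `J`, and evaluating `∑_{T ∩ J = ∅} f T` by inclusion–exclusion, gives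
`c = (-1) ^ j * (a - j).choose (k - j)` (`eigenvalue_eq_of_minimal_supersetSum_ne_zero`). If the
entries of `f` have nonzero sum then `j = 0` and `c` is the degree `d = a.choose k`; if the sum is
zero then `j ≥ 1`, and `c > 0` forces `j ≥ 2`, so `c ≤ θ = (a - 2).choose (k - 2)`. Two independent
eigenvectors with nonzero sums can be combined into one with sum zero, so every eigenvalue except
the first is at most `θ` (`adjEigenvalue_le_of_pos`). The clique number is `ω = ⌊p / k⌋`, and the
sum of squares is therefore at most `d ^ 2 + (ω - 1) * θ ^ 2`.

The graph has `n * d / 2` edges, so it remains to prove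
`d ^ 2 + (ω - 1) * θ ^ 2 ≤ n * d * (ω - 1) / ω`. Writing `d` as a multiple of `θ`, and `n` as a
multiple of `(p - 2).choose (k - 2) ≥ θ`, turns this into a polynomial inequality in `a`, `k` and
`ω` subject to `k * ω ≤ a + k < k * (ω + 1)` (`ratio_inequality`).
-/

/-! ### Counting in the Kneser graph -/

open Finset in
/-- The number of `k`-sets containing `J` and disjoint from `T`. -/
theorem card_superset_disjoint {p k : ℕ} {J T : Finset (Fin p)} (hJ : J.card ≤ k)
    (hT : T.card = k) (hJT : Disjoint J T) :
    (univ.filter fun S : {s : Finset (Fin p) // s.card = k} => J ⊆ S.1 ∧ Disjoint S.1 T).card =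
      (p - k - J.card).choose (k - J.card) := by
  have hc : ((J ∪ T)ᶜ).card = p - k - J.card := by
    rw [card_compl, card_union_of_disjoint hJT, Fintype.card_fin, hT]
    omega
  rw [← hc, ← card_powersetCard]
  refine card_bij (fun S _ => S.1 \ J) ?_ ?_ ?_
  · intro S hS
    simp only [mem_filter, mem_univ, true_and] at hS
    rw [mem_powersetCard, card_sdiff_of_subset hS.1, S.2]
    refine ⟨?_, rfl⟩
    intro x hx
    rw [mem_sdiff] at hx
    simp only [mem_compl, mem_union, not_or]
    exact ⟨hx.2, disjoint_left.1 hS.2 hx.1⟩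
  · intro S hS S' hS' h
    simp only [mem_filter, mem_univ, true_and] at hS hS'
    apply Subtype.ext
    rw [← sdiff_union_of_subset hS.1, ← sdiff_union_of_subset hS'.1]
    exact congrArg (· ∪ J) h
  · intro U hU
    rw [mem_powersetCard] at hU
    have hUJ : Disjoint U J := disjoint_left.2 fun x hx hxJ => by
      simpa [hxJ] using hU.1 hx
    have hUT : Disjoint U T := disjoint_left.2 fun x hx hxT => by
      simpa [hxT] using hU.1 hx
    refine ⟨⟨U ∪ J, ?_⟩, ?_, ?_⟩
    · rw [card_union_of_disjoint hUJ, hU.2]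
      omega
    · simp only [mem_filter, mem_univ, true_and, disjoint_union_left]
      exact ⟨subset_union_right, hUT, hJT⟩
    · exact union_sdiff_cancel_right hUJ

theorem kneserGraph_adj_iff {p k : ℕ} (hk : 1 ≤ k) (S T : {s : Finset (Fin p) // s.card = k}) :
    (kneserGraph p k).Adj S T ↔ Disjoint S.1 T.1 := by
  refine ⟨fun h => h.2, fun h => ⟨?_, h⟩⟩
  rintro rfl
  have := S.2
  rw [disjoint_self, Finset.bot_eq_empty] at h
  rw [h, Finset.card_empty] at this
  omega

theorem kneserGraph_degree {p k : ℕ} (hk : 1 ≤ k) (T : {s : Finset (Fin p) // s.card = k}) :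
    (kneserGraph p k).degree T = (p - k).choose k := by
  have h := card_superset_disjoint (J := ∅) (Nat.zero_le k) T.2 (Finset.disjoint_empty_left _)
  rw [Finset.card_empty, Nat.sub_zero, Nat.sub_zero] at h
  rw [← h, ← SimpleGraph.card_neighborFinset_eq_degree]
  congr 1
  ext S
  simp [kneserGraph_adj_iff hk, disjoint_comm]

theorem two_mul_card_edgeFinset_kneserGraph {p k : ℕ} (hk : 1 ≤ k) :
    2 * (kneserGraph p k).edgeFinset.card = p.choose k * (p - k).choose k := by
  rw [← SimpleGraph.sum_degrees_eq_twice_card_edges]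
  simp only [kneserGraph_degree hk, Finset.sum_const, smul_eq_mul, Finset.card_univ,
    Fintype.card_finset_len, Fintype.card_fin]

/-! ### Superset sums and eigenvectors -/

/-- The sum of a function on the `k`-sets over the `k`-sets that contain `J`. -/
noncomputable def supersetSum {p k : ℕ} (f : {s : Finset (Fin p) // s.card = k} → ℝ)
    (J : Finset (Fin p)) : ℝ :=
  ∑ T with J ⊆ T.1, f T

theorem supersetSum_eq_zero_of_lt_card {p k : ℕ} (f : {s : Finset (Fin p) // s.card = k} → ℝ)
    {J : Finset (Fin p)} (hJ : k < J.card) : supersetSum f J = 0 := by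
  refine Finset.sum_eq_zero fun T hT => ?_
  have := Finset.card_le_card (Finset.mem_filter.1 hT).2
  rw [T.2] at this
  omega

theorem supersetSum_of_val {p k : ℕ} (f : {s : Finset (Fin p) // s.card = k} → ℝ)
    (T : {s : Finset (Fin p) // s.card = k}) : supersetSum f T.1 = f T := by
  unfold supersetSum
  rw [Finset.sum_eq_single T]
  · intro S hS hST
    refine absurd (Subtype.ext ?_) hST
    exact (Finset.eq_of_subset_of_card_le (Finset.mem_filter.1 hS).2 (by rw [S.2, T.2])).symm
  · intro h
    simp at h

theorem supersetSum_empty {p k : ℕ} (f : {s : Finset (Fin p) // s.card = k} → ℝ) :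
    supersetSum f ∅ = ∑ T, f T := by
  simp [supersetSum]

theorem supersetSum_smul {p k : ℕ} (c : ℝ) (f : {s : Finset (Fin p) // s.card = k} → ℝ)
    (J : Finset (Fin p)) : supersetSum (c • f) J = c * supersetSum f J := by
  simp [supersetSum, Finset.mul_sum]

/-- Inclusion–exclusion over the subsets of `J`. -/
theorem sum_disjoint_eq_sum_powerset {p k : ℕ} (f : {s : Finset (Fin p) // s.card = k} → ℝ)
    (J : Finset (Fin p)) :
    ∑ T with Disjoint J T.1, f T = ∑ I ∈ J.powerset, (-1 : ℝ) ^ I.card * supersetSum f I := by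
  simp only [supersetSum, Finset.mul_sum, Finset.sum_filter]
  rw [Finset.sum_comm]
  refine Finset.sum_congr rfl fun T _ => ?_
  have h := congrArg (Int.cast : ℤ → ℝ) (Finset.sum_powerset_neg_one_pow_card (x := J ∩ T.1))
  push_cast at h
  have h2 : (J ∩ T.1).powerset = J.powerset.filter (· ⊆ T.1) := by
    ext I
    rw [Finset.mem_powerset, Finset.subset_inter_iff, Finset.mem_filter, Finset.mem_powerset]
  rw [h2, Finset.sum_filter] at h
  simp only [← Finset.disjoint_iff_inter_eq_empty] at h
  simp only [mul_ite, mul_zero]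
  calc (if Disjoint J T.1 then f T else 0) = (if Disjoint J T.1 then (1 : ℝ) else 0) * f T := by
        split_ifs <;> simp
    _ = _ := by
        rw [← h, Finset.sum_mul]
        exact Finset.sum_congr rfl fun I _ => by split_ifs <;> simp

theorem supersetSum_adjMatrix_mulVec {p k : ℕ} (hk : 1 ≤ k)
    (f : {s : Finset (Fin p) // s.card = k} → ℝ) {J : Finset (Fin p)} (hJ : J.card ≤ k) :
    supersetSum (((kneserGraph p k).adjMatrix ℝ).mulVec f) J =
      (p - k - J.card).choose (k - J.card) * ∑ T with Disjoint J T.1, f T := by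
  have h1 : ∀ S, ((kneserGraph p k).adjMatrix ℝ).mulVec f S =
      ∑ T, if Disjoint S.1 T.1 then f T else 0 := by
    intro S
    simp [Matrix.mulVec, dotProduct, SimpleGraph.adjMatrix_apply, kneserGraph_adj_iff hk]
  simp only [supersetSum, h1]
  rw [Finset.sum_comm, Finset.sum_filter, Finset.mul_sum]
  refine Finset.sum_congr rfl fun T _ => ?_
  rw [← Finset.sum_filter, Finset.filter_filter, Finset.sum_const, nsmul_eq_mul]
  split_ifs with h
  · rw [card_superset_disjoint hJ T.2 h]
  · rw [Finset.filter_false_of_mem, Finset.card_empty]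
    · simp
    · rintro S - ⟨hJS, hST⟩
      exact h (hST.mono_left hJS)

/-- The smallest sets on which the superset sums of an eigenvector do not vanish determine its
eigenvalue: only the term `I = J` survives in the inclusion–exclusion formula. -/
theorem eigenvalue_eq_of_minimal_supersetSum_ne_zero {p k : ℕ} (hk : 1 ≤ k)
    {f : {s : Finset (Fin p) // s.card = k} → ℝ} {c : ℝ}
    (hf : ((kneserGraph p k).adjMatrix ℝ).mulVec f = c • f) {J : Finset (Fin p)}
    (hJ : supersetSum f J ≠ 0) (hmin : ∀ I, supersetSum f I ≠ 0 → J.card ≤ I.card) :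
    c = (-1) ^ J.card * (p - k - J.card).choose (k - J.card) := by
  have hJk : J.card ≤ k := by
    by_contra! h
    exact hJ (supersetSum_eq_zero_of_lt_card f h)
  have h := supersetSum_adjMatrix_mulVec hk f hJk
  rw [hf, supersetSum_smul, sum_disjoint_eq_sum_powerset, Finset.sum_eq_single J] at h
  · apply mul_right_cancel₀ hJ
    rw [h]
    ring
  · intro I hI hIJ
    have hlt : I.card < J.card :=
      Finset.card_lt_card ((Finset.mem_powerset.1 hI).ssubset_of_ne hIJ)
    have : supersetSum f I = 0 := by
      by_contra h0
      exact absurd (hmin I h0) (by omega)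
    rw [this, mul_zero]
  · intro h0
    simp at h0

theorem exists_minimal_supersetSum_ne_zero {p k : ℕ}
    {f : {s : Finset (Fin p) // s.card = k} → ℝ} (hf : f ≠ 0) :
    ∃ J, supersetSum f J ≠ 0 ∧ ∀ I, supersetSum f I ≠ 0 → J.card ≤ I.card := by
  obtain ⟨T, hT⟩ := Function.ne_iff.1 hf
  obtain ⟨J, hJ, hmin⟩ := Finset.exists_min_image
    (Finset.univ.filter fun J => supersetSum f J ≠ 0) Finset.card
    ⟨T.1, by simpa [supersetSum_of_val] using hT⟩
  exact ⟨J, by simpa using hJ, fun I hI => hmin I (by simpa using hI)⟩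

theorem eigenvalue_eq_of_sum_ne_zero {p k : ℕ} (hk : 1 ≤ k)
    {f : {s : Finset (Fin p) // s.card = k} → ℝ} {c : ℝ}
    (hf : ((kneserGraph p k).adjMatrix ℝ).mulVec f = c • f) (hs : ∑ T, f T ≠ 0) :
    c = (p - k).choose k := by
  rw [← supersetSum_empty] at hs
  simpa using eigenvalue_eq_of_minimal_supersetSum_ne_zero hk hf hs (by simp)

theorem choose_sub_sub_antitone (n k : ℕ) (hkn : k ≤ n) :
    AntitoneOn (fun j => (n - j).choose (k - j)) (Set.Iic k) := by
  intro i hi j hj hij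
  simp only [Set.mem_Iic] at hi hj
  show (n - j).choose (k - j) ≤ (n - i).choose (k - i)
  rw [← Nat.choose_symm (by omega : k - j ≤ n - j), ← Nat.choose_symm (by omega : k - i ≤ n - i),
    show n - j - (k - j) = n - k by omega, show n - i - (k - i) = n - k by omega]
  exact Nat.choose_le_choose _ (by omega)

/-- The superset sum at `∅` vanishes, so the minimal size is positive; odd sizes give eigenvalues
`≤ 0`, so a positive eigenvalue comes from a size at least `2`. -/
theorem eigenvalue_le_of_sum_eq_zero {p k : ℕ} (hk : 2 ≤ k) (hkp : 2 * k ≤ p)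
    {f : {s : Finset (Fin p) // s.card = k} → ℝ} {c : ℝ} (hf0 : f ≠ 0)
    (hf : ((kneserGraph p k).adjMatrix ℝ).mulVec f = c • f) (hs : ∑ T, f T = 0) :
    c ≤ (p - k - 2).choose (k - 2) := by
  obtain ⟨J, hJ, hmin⟩ := exists_minimal_supersetSum_ne_zero hf0
  have hJk : J.card ≤ k := by
    by_contra! h
    exact hJ (supersetSum_eq_zero_of_lt_card f h)
  have hJ0 : J.card ≠ 0 := by
    intro h
    rw [Finset.card_eq_zero.1 h, supersetSum_empty] at hJ
    exact hJ hs
  rw [eigenvalue_eq_of_minimal_supersetSum_ne_zero (by omega) hf hJ hmin]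
  rcases Nat.even_or_odd J.card with he | ho
  · rw [he.neg_one_pow, one_mul]
    have : 2 ≤ J.card := by
      obtain ⟨r, hr⟩ := he
      omega
    exact_mod_cast choose_sub_sub_antitone (p - k) k (by omega) (Set.mem_Iic.2 hk) hJk this
  · rw [ho.neg_one_pow]
    have h1 : (0 : ℝ) ≤ ((p - k - J.card).choose (k - J.card) : ℕ) := Nat.cast_nonneg _
    have h2 : (0 : ℝ) ≤ ((p - k - 2).choose (k - 2) : ℕ) := Nat.cast_nonneg _
    linarith

/-! ### The clique number -/

theorem card_mul_le_of_isClique_kneserGraph {p k : ℕ}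
    {s : Finset {s : Finset (Fin p) // s.card = k}}
    (hs : (kneserGraph p k).IsClique s) : s.card * k ≤ p := by
  have h := Finset.card_biUnion (s := s) (t := fun S => S.1) fun S hS T hT hST => (hs hS hT hST).2
  rw [Finset.sum_congr rfl fun S _ => S.2, Finset.sum_const, smul_eq_mul] at h
  rw [← h]
  exact (Finset.card_le_univ _).trans_eq (Fintype.card_fin p)

/-- The blocks `{ik, …, ik + k - 1}` for `i < ⌊p / k⌋` form a clique of maximal size. -/
theorem cliqueNum_kneserGraph {p k : ℕ} (hk : 1 ≤ k) : (kneserGraph p k).cliqueNum = p / k := by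
  apply le_antisymm
  · obtain ⟨s, hs⟩ := (kneserGraph p k).exists_isNClique_cliqueNum
    rw [← hs.card_eq, Nat.le_div_iff_mul_le hk]
    exact card_mul_le_of_isClique_kneserGraph hs.isClique
  · have hlt : ∀ i : Fin (p / k), ∀ x ∈ Finset.Ico (i.val * k) (i.val * k + k), x < p := by
      intro i x hx
      have h1 : (i.val + 1) * k ≤ p / k * k := Nat.mul_le_mul_right k i.2
      have h2 := Nat.div_mul_le_self p k
      have h3 := (Finset.mem_Ico.1 hx).2
      linarith
    let B : Fin (p / k) → {s : Finset (Fin p) // s.card = k} := fun i =>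
      ⟨Finset.attachFin _ (hlt i), by simp⟩
    have hB : ∀ i j, i ≠ j → Disjoint (B i).1 (B j).1 := by
      intro i j hij
      rw [Finset.disjoint_left]
      intro x hi hj
      simp only [B, Finset.mem_attachFin, Finset.mem_Ico] at hi hj
      apply hij
      apply Fin.ext
      have h1 : x.val / k = i.val := Nat.div_eq_of_lt_le hi.1 (by linarith [hi.2])
      have h2 : x.val / k = j.val := Nat.div_eq_of_lt_le hj.1 (by linarith [hj.2])
      omega
    have hadj : ∀ i j, i ≠ j → (kneserGraph p k).Adj (B i) (B j) := fun i j hij =>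
      (kneserGraph_adj_iff hk _ _).2 (hB i j hij)
    have hinj : Function.Injective B := by
      intro i j h
      by_contra hij
      exact (hadj i j hij).ne h
    have hc : (kneserGraph p k).IsClique (Finset.univ.map ⟨B, hinj⟩ : Finset _) := by
      intro S hS T hT hST
      simp only [Finset.coe_map, Function.Embedding.coeFn_mk, Finset.coe_univ, Set.image_univ,
        Set.mem_range] at hS hT
      obtain ⟨i, rfl⟩ := hS
      obtain ⟨j, rfl⟩ := hT
      exact hadj i j fun h => hST (congrArg B h)
    simpa using hc.card_le_cliqueNum

/-! ### Ordered adjacency eigenvalues -/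

theorem exists_eigenvector_adjEigenvalue {V : Type*} [Fintype V] [DecidableEq V]
    (G : SimpleGraph V) [DecidableRel G.Adj] :
    ∃ v : Fin (Fintype.card V) → V → ℝ, LinearIndependent ℝ v ∧
      ∀ i, (G.adjMatrix ℝ).mulVec (v i) = adjEigenvalue G i • v i := by
  let hA := adjMatrix_isHermitian_real G
  let e : Fin (Fintype.card V) ≃ V := Fintype.equivOfCardEq (Fintype.card_fin _)
  refine ⟨fun i => ⇑(hA.eigenvectorBasis (e i)), ?_, fun i => ?_⟩
  · have h := hA.eigenvectorBasis.toBasis.linearIndependent.comp e e.injective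
    exact h.map' (WithLp.linearEquiv 2 ℝ (V → ℝ)).toLinearMap (LinearEquiv.ker _)
  · have h := hA.mulVec_eigenvectorBasis (e i)
    have h2 : hA.eigenvalues (e i) = adjEigenvalue G i := by
      simp only [Matrix.IsHermitian.eigenvalues, e, Equiv.symm_apply_apply, adjEigenvalue]
    rwa [h2] at h

theorem adjEigenvalue_pos_of_lt_numPosEigenvalues {V : Type*} [Fintype V] [DecidableEq V]
    (G : SimpleGraph V) [DecidableRel G.Adj] {i : Fin (Fintype.card V)}
    (hi : i.val < numPosEigenvalues G) : 0 < adjEigenvalue G i := by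
  by_contra! h
  have hsub : (Finset.univ.filter fun j => 0 < adjEigenvalue G j) ⊆ Finset.Iio i := by
    intro j hj
    rw [Finset.mem_Iio]
    by_contra! hij
    exact absurd ((Finset.mem_filter.1 hj).2.trans_le (adjEigenvalue_antitone G hij)) h.not_gt
  have := Finset.card_le_card hsub
  rw [Fin.card_Iio] at this
  exact absurd hi (by simpa [numPosEigenvalues] using this)

theorem adjEigenvalue_le_choose {p k : ℕ} (hk : 2 ≤ k) (hkp : 2 * k ≤ p)
    (i : Fin (Fintype.card {s : Finset (Fin p) // s.card = k})) :
    adjEigenvalue (kneserGraph p k) i ≤ (p - k).choose k := by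
  obtain ⟨v, hv, hev⟩ := exists_eigenvector_adjEigenvalue (kneserGraph p k)
  by_cases hs : ∑ T, v i T = 0
  · refine (eigenvalue_le_of_sum_eq_zero hk hkp (hv.ne_zero i) (hev i) hs).trans ?_
    have h := choose_sub_sub_antitone (p - k) k (by omega) (Set.mem_Iic.2 (Nat.zero_le k))
      (Set.mem_Iic.2 hk) (Nat.zero_le 2)
    exact_mod_cast h
  · exact (eigenvalue_eq_of_sum_ne_zero (by omega) (hev i) hs).le

/-- Two independent eigenvectors whose entries have nonzero sum both belong to the degree of the
graph, and a combination of them is an eigenvector with zero sum. Hence all eigenvalues but the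
largest obey the bound for eigenvectors with zero sum. -/
theorem adjEigenvalue_le_of_pos {p k : ℕ} (hk : 2 ≤ k) (hkp : 2 * k ≤ p)
    {i : Fin (Fintype.card {s : Finset (Fin p) // s.card = k})} (hi : 0 < i.val) :
    adjEigenvalue (kneserGraph p k) i ≤ (p - k - 2).choose (k - 2) := by
  obtain ⟨v, hv, hev⟩ := exists_eigenvector_adjEigenvalue (kneserGraph p k)
  let o : Fin (Fintype.card {s : Finset (Fin p) // s.card = k}) := ⟨0, hi.trans i.2⟩
  have hoi : o ≠ i := fun h => hi.ne (congrArg Fin.val h)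
  have hle : adjEigenvalue (kneserGraph p k) i ≤ adjEigenvalue (kneserGraph p k) o :=
    adjEigenvalue_antitone _ (Fin.le_def.2 (Nat.zero_le _))
  by_cases hsi : ∑ T, v i T = 0
  · exact eigenvalue_le_of_sum_eq_zero hk hkp (hv.ne_zero i) (hev i) hsi
  by_cases hso : ∑ T, v o T = 0
  · exact hle.trans (eigenvalue_le_of_sum_eq_zero hk hkp (hv.ne_zero o) (hev o) hso)
  have hei := hev i
  have heo := hev o
  rw [eigenvalue_eq_of_sum_ne_zero (by omega) (hev i) hsi] at hei ⊢
  rw [eigenvalue_eq_of_sum_ne_zero (by omega) (hev o) hso] at heo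
  refine eigenvalue_le_of_sum_eq_zero (f := (∑ T, v o T) • v i - (∑ T, v i T) • v o) hk hkp
    ?_ ?_ ?_
  -- The combination is nonzero, as its coefficient at `v i` is.
  · intro h
    have hpair : LinearIndependent ℝ ![v i, v o] := by
      convert hv.comp ![i, o] (by simpa [Function.Injective, Fin.forall_fin_two] using ⟨hoi.symm, hoi⟩) using 1
      ext j
      fin_cases j <;> rfl
    have hp := LinearIndependent.pair_iff.1 hpair (∑ T, v o T)
      (-∑ T, v i T) (by rw [neg_smul, ← sub_eq_add_neg]; exact h)
    exact hso hp.1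
  · rw [Matrix.mulVec_sub, Matrix.mulVec_smul, Matrix.mulVec_smul, hei, heo, smul_sub,
      smul_comm, smul_comm _ (∑ T, v i T)]
  · simp only [Pi.sub_apply, Pi.smul_apply, smul_eq_mul, Finset.sum_sub_distrib,
      ← Finset.mul_sum]
    ring

theorem adjEigenvalue_eq_zero_of_lt {p k : ℕ} (hkp : p < 2 * k)
    (i : Fin (Fintype.card {s : Finset (Fin p) // s.card = k})) :
    adjEigenvalue (kneserGraph p k) i = 0 := by
  obtain ⟨v, hv, hev⟩ := exists_eigenvector_adjEigenvalue (kneserGraph p k)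
  have hA : (kneserGraph p k).adjMatrix ℝ = 0 := by
    ext S T
    have : ¬ (kneserGraph p k).Adj S T := by
      intro h
      have h2 := Finset.card_union_of_disjoint h.2
      have h3 := (Finset.card_le_univ (S.1 ∪ T.1)).trans_eq (Fintype.card_fin p)
      rw [S.2, T.2] at h2
      omega
    simp [SimpleGraph.adjMatrix_apply, this]
  have h := hev i
  rw [hA, Matrix.zero_mulVec, eq_comm, smul_eq_zero] at h
  exact h.resolve_right (hv.ne_zero i)

/-- Only positive eigenvalues are summed, so the upper bounds on the eigenvalues may be squared. -/
theorem sumSqLargestEigenvalues_kneserGraph_le {p k : ℕ} (hk : 2 ≤ k) (hkp : 2 * k ≤ p) {w : ℕ}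
    (hw : 1 ≤ w) :
    sumSqLargestEigenvalues (kneserGraph p k) (min (numPosEigenvalues (kneserGraph p k)) w) ≤
      ((p - k).choose k : ℝ) ^ 2 + (w - 1) * ((p - k - 2).choose (k - 2) : ℝ) ^ 2 := by
  let b : ℕ → ℝ := fun j =>
    if j = 0 then ((p - k).choose k : ℝ) ^ 2 else ((p - k - 2).choose (k - 2) : ℝ) ^ 2
  have hb : ∀ j, 0 ≤ b j := fun j => by
    simp only [b]
    split_ifs <;> positivity
  calc sumSqLargestEigenvalues (kneserGraph p k) (min (numPosEigenvalues (kneserGraph p k)) w)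
      ≤ ∑ i : Fin (Fintype.card {s : Finset (Fin p) // s.card = k})
          with i.val < min (numPosEigenvalues (kneserGraph p k)) w, b i.val := by
        refine Finset.sum_le_sum fun i hi => ?_
        have hi' := (Finset.mem_filter.1 hi).2
        have hpos := adjEigenvalue_pos_of_lt_numPosEigenvalues (kneserGraph p k)
          (hi'.trans_le (min_le_left _ _))
        simp only [b]
        split_ifs with h0
        · exact pow_le_pow_left₀ hpos.le (adjEigenvalue_le_choose hk hkp i) 2
        · exact pow_le_pow_left₀ hpos.le
            (adjEigenvalue_le_of_pos hk hkp (Nat.pos_of_ne_zero h0)) 2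
    _ ≤ ∑ j ∈ Finset.range w, b j := by
        rw [← Finset.sum_image (f := b) (g := Fin.val) (Fin.val_injective.injOn)]
        refine Finset.sum_le_sum_of_subset_of_nonneg ?_ fun j _ _ => hb j
        intro j hj
        obtain ⟨i, hi, rfl⟩ := Finset.mem_image.1 hj
        exact Finset.mem_range.2 ((Finset.mem_filter.1 hi).2.trans_le (min_le_right _ _))
    _ = _ := by
        obtain ⟨u, rfl⟩ := Nat.exists_eq_add_of_le' hw
        rw [Finset.sum_range_succ']
        simp [b]
        ring

/-! ### The inequality between binomial coefficients -/

theorem mul_choose_eq_mul_choose_sub_two {n k : ℕ} (hk : 2 ≤ k) (hn : 2 ≤ n) :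
    ((k : ℝ) * (k - 1)) * n.choose k = (n * (n - 1)) * (n - 2).choose (k - 2) := by
  obtain ⟨k, rfl⟩ := Nat.exists_eq_add_of_le' hk
  obtain ⟨n, rfl⟩ := Nat.exists_eq_add_of_le' hn
  have h1 : ((n : ℝ) + 1 + 1) * (n + 1).choose (k + 1) = (n + 2).choose (k + 2) * (k + 1 + 1) := by
    exact_mod_cast Nat.add_one_mul_choose_eq (n + 1) (k + 1)
  have h2 : ((n : ℝ) + 1) * n.choose k = (n + 1).choose (k + 1) * (k + 1) := by
    exact_mod_cast Nat.add_one_mul_choose_eq n k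
  rw [Nat.add_sub_cancel, Nat.add_sub_cancel]
  push_cast
  linear_combination -(k + 1 : ℝ) * h1 - (n + 2 : ℝ) * h2

/-- The substitution makes the difference of the two sides a polynomial in `t` and `s` with
nonnegative coefficients. -/
theorem ratio_inequality_two (t s : ℝ) (ht : 0 ≤ t) (hs : 0 ≤ s) :
    let k := t + 1 + s
    let a := k + t
    2 * ((a * (a - 1)) ^ 2 + (k * (k - 1)) ^ 2) ≤ (a + k) * (a + k - 1) * (a * (a - 1)) := by
  intro k a
  rw [← sub_nonneg]
  simp only [k, a]
  ring_nf
  positivity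

theorem ratio_inequality_three {a k w : ℝ} (hk : 2 ≤ k) (hw : 3 ≤ w) (h1 : k * (w - 1) ≤ a)
    (h2 : a ≤ k * w - 1) :
    w * ((a * (a - 1)) ^ 2 + (w - 1) * (k * (k - 1)) ^ 2) ≤
      (a + k) * (a + k - 1) * (a * (a - 1)) * (w - 1) := by
  have ha : 0 ≤ a := by nlinarith
  have hK : 0 ≤ k * (k - 1) := by nlinarith
  have hA : (w - 1) ^ 2 * (k * (k - 1)) ≤ a * (a - 1) := by
    have : (k * (w - 1)) * ((w - 1) * (k - 1)) ≤ a * (a - 1) := by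
      apply mul_le_mul h1 _ (by nlinarith) ha
      nlinarith
    nlinarith
  have hb : (w - 1) * (k * (k - 1)) ≤ (w - 1) * (2 * a * k + k * (k - 1)) - a * (a - 1) := by
    have : a * (a - 1) ≤ a * (k * w - 2) := mul_le_mul_of_nonneg_left (by linarith) ha
    have : 0 ≤ a * k * (w - 2) := mul_nonneg (by nlinarith) (by linarith)
    nlinarith
  have hm := mul_le_mul hA hb (mul_nonneg (by linarith) hK) (le_trans (by positivity) hA)
  have : w * (w - 1) * (k * (k - 1)) ^ 2 ≤
      (w - 1) ^ 2 * (k * (k - 1)) * ((w - 1) * (k * (k - 1))) := by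
    have h : w ≤ (w - 1) ^ 2 := by nlinarith
    have := mul_le_mul_of_nonneg_right h
      (mul_nonneg (by linarith : 0 ≤ w - 1) (sq_nonneg (k * (k - 1))))
    nlinarith
  nlinarith

/-- The eigenvalue inequality cleared of binomial coefficients, with `a = p - k` and
`w = ⌊p / k⌋`. -/
theorem ratio_inequality {a k w : ℕ} (hk : 2 ≤ k) (hw : 2 ≤ w) (h1 : k * w ≤ a + k)
    (h2 : a + 1 ≤ k * w) :
    (w : ℝ) * ((a * (a - 1)) ^ 2 + (w - 1) * (k * (k - 1)) ^ 2) ≤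
      (a + k) * (a + k - 1) * (a * (a - 1)) * (w - 1) := by
  rcases hw.eq_or_lt with rfl | hw
  · -- Here `k ≤ a ≤ 2 * k - 1`, so both slacks are nonnegative.
    obtain ⟨t, rfl⟩ := Nat.exists_eq_add_of_le (show k ≤ a by omega)
    obtain ⟨s, rfl⟩ := Nat.exists_eq_add_of_le (show t + 1 ≤ k by omega)
    have := ratio_inequality_two t s (Nat.cast_nonneg _) (Nat.cast_nonneg _)
    push_cast
    linarith
  · refine ratio_inequality_three (by exact_mod_cast hk) (by exact_mod_cast hw) ?_ ?_
    · have : (k : ℝ) * w ≤ a + k := by exact_mod_cast h1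
      linarith
    · have : (a : ℝ) + 1 ≤ k * w := by exact_mod_cast h2
      linarith

theorem sq_add_mul_sq_le_of_two_mul_le {p k : ℕ} (hk : 2 ≤ k) (hkp : 2 * k ≤ p) :
    ((p - k).choose k : ℝ) ^ 2 + ((p / k : ℕ) - 1) * ((p - k - 2).choose (k - 2) : ℝ) ^ 2 ≤
      p.choose k * (p - k).choose k * ((p / k : ℕ) - 1) / (p / k : ℕ) := by
  obtain ⟨a, rfl⟩ := Nat.exists_eq_add_of_le' (show k ≤ p by omega)
  rw [Nat.add_sub_cancel]
  have hw : 2 ≤ (a + k) / k := (Nat.le_div_iff_mul_le (by omega)).2 hkp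
  have hr := ratio_inequality (a := a) hk hw (Nat.mul_div_le _ _)
    (by have := Nat.lt_mul_div_succ (a + k) (show 0 < k by omega); rw [Nat.mul_succ] at this; omega)
  generalize (a + k) / k = w at hw hr ⊢
  have hD := mul_choose_eq_mul_choose_sub_two (n := a) hk (by omega)
  have hN := mul_choose_eq_mul_choose_sub_two (n := a + k) hk (by omega)
  have hmono : ((a - 2).choose (k - 2) : ℝ) ≤ (a + k - 2).choose (k - 2) := by
    exact_mod_cast Nat.choose_le_choose _ (by omega)
  push_cast at hN
  set x : ℝ := ((a - 2).choose (k - 2) : ℝ)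
  set y : ℝ := ((a + k - 2).choose (k - 2) : ℝ)
  set D : ℝ := (a.choose k : ℝ)
  set N : ℝ := ((a + k).choose k : ℝ)
  have hx : 0 ≤ x := Nat.cast_nonneg _
  have hk' : (2 : ℝ) ≤ k := by exact_mod_cast hk
  have ha' : (2 : ℝ) ≤ a := by exact_mod_cast (show 2 ≤ a by omega)
  have hw' : (2 : ℝ) ≤ w := by exact_mod_cast hw
  have hK : (0 : ℝ) < k * (k - 1) := mul_pos (by linarith) (by linarith)
  have hA : (0 : ℝ) ≤ a * (a - 1) := mul_nonneg (by linarith) (by linarith)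
  have hP : (0 : ℝ) ≤ (a + k) * (a + k - 1) := mul_nonneg (by linarith) (by linarith)
  rw [le_div_iff₀ (by linarith)]
  -- After scaling by `(k * (k - 1)) ^ 2` every binomial coefficient is a multiple of `x` or `y`.
  refine le_of_mul_le_mul_left ?_ (pow_pos hK 2)
  calc ((k : ℝ) * (k - 1)) ^ 2 * ((D ^ 2 + (w - 1) * x ^ 2) * w)
      = w * ((k * (k - 1) * D) ^ 2 + (w - 1) * (k * (k - 1)) ^ 2 * x ^ 2) := by ring
    _ = w * ((a * (a - 1)) ^ 2 + (w - 1) * (k * (k - 1)) ^ 2) * (x * x) := by rw [hD]; ring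
    _ ≤ (a + k) * (a + k - 1) * (a * (a - 1)) * (w - 1) * (x * x) :=
        mul_le_mul_of_nonneg_right hr (mul_nonneg hx hx)
    _ ≤ (a + k) * (a + k - 1) * (a * (a - 1)) * (w - 1) * (y * x) :=
        mul_le_mul_of_nonneg_left (mul_le_mul_of_nonneg_right hmono hx)
          (mul_nonneg (mul_nonneg hP hA) (by linarith))
    _ = ((a + k) * (a + k - 1) * y) * (a * (a - 1) * x) * (w - 1) := by ring
    _ = ((k : ℝ) * (k - 1)) ^ 2 * (N * D * (w - 1)) := by rw [← hN, ← hD]; ring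

/-! ### The sum of the largest squared eigenvalues -/

theorem mainTheorem1 (p k : ℕ) (hk : 2 ≤ k) (hkp : k ≤ p) :
    sumSqLargestEigenvalues (kneserGraph p k)
        (min (numPosEigenvalues (kneserGraph p k)) (kneserGraph p k).cliqueNum) ≤
      2 * ((kneserGraph p k).edgeFinset.card : ℝ) * (((kneserGraph p k).cliqueNum : ℝ) - 1) /
        ((kneserGraph p k).cliqueNum : ℝ) := by
  have hk1 : 1 ≤ k := by omega
  have hm : 2 * ((kneserGraph p k).edgeFinset.card : ℝ) = p.choose k * (p - k).choose k := by
    exact_mod_cast two_mul_card_edgeFinset_kneserGraph (p := p) hk1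
  rw [hm, cliqueNum_kneserGraph hk1]
  rcases lt_or_ge p (2 * k) with h | h
  · rw [Nat.choose_eq_zero_of_lt (show p - k < k by omega)]
    simp [sumSqLargestEigenvalues, adjEigenvalue_eq_zero_of_lt h]
  · exact (sumSqLargestEigenvalues_kneserGraph_le hk h ((Nat.one_le_div_iff hk1).2 hkp)).trans
      (sq_add_mul_sq_le_of_two_mul_le hk h)
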